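/- Let $H$ be a complex Hilbert space (of arbitrary dimension) and let $B(H)$ be the algebra of bounded linear operators on $H$. For real $\alpha,\beta$, $1\le p<\infty$, a positive invertible $P\in B(H)$ and $X\in B(H)$, put $$\Lambda_{\alpha,\beta,p}(P,X):=\mathrm{Tr}\,\bigl|P^{\alpha/p}XP^{\beta/p}\bigr|^p\in[0,\infty],$$ where $|T|=(T^*T)^{1/2}$. A UCPTP map over $B(H)$ is a linear map $\phi:B(H)\to B(H)$ that is completely positive, unital ($\phi(\mathbf 1)=\mathbf 1$) and trace preserving ($\mathrm{Tr}\,\phi(A)=\mathrm{Tr}\,A$ for every trace class $A$). Suppose $\alpha+\beta=-1$, $\alpha\in[-1,0]$ and $2\le p<\infty$. Then for every positive invertible $P\in B(H)$, every $X\in B(H)$ and every UCPTP map $\phi$ over $B(H)$, $$\Lambda_{\alpha,\beta,p}(\phi(P),\phi(X))\le\Lambda_{\alpha,\beta,p}(P,X).$$ -/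

import Mathlib

open scoped ENNReal CStarAlgebra InnerProductSpace

section OperatorTrace

variable {H : Type*} [NormedAddCommGroup H] [InnerProductSpace ℂ H]

lemma ofReal_norm_sq_eq_tsum {ι : Type*} (e : HilbertBasis ι ℂ H) (x : H) :
    ENNReal.ofReal (‖x‖ ^ 2) = ∑' i, ENNReal.ofReal (‖⟪e i, x⟫_ℂ‖ ^ 2) := by
  have h := e.hasSum_inner_mul_inner x x
  have h2 : HasSum (fun i => ‖⟪e i, x⟫_ℂ‖ ^ 2) (‖x‖ ^ 2) := by
    have h3 := Complex.hasSum_re h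
    convert h3 using 1
    · funext i
      rw [← inner_conj_symm x (e i), Complex.conj_mul']
      norm_cast
    · exact norm_sq_eq_re_inner (𝕜 := ℂ) x
  rw [← h2.tsum_eq, ENNReal.ofReal_tsum_of_nonneg (fun i => by positivity) h2.summable]

/-- The sum `∑ᵢ ⟨eᵢ, A eᵢ⟩ ∈ [0, ∞]` over a Hilbert basis `e`, for a positive operator `A`. -/
noncomputable def traceAlong {ι : Type*} (e : HilbertBasis ι ℂ H) (A : H →L[ℂ] H) : ℝ≥0∞ :=
  ∑' i, ENNReal.ofReal (RCLike.re ⟪e i, A (e i)⟫_ℂ)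

variable [CompleteSpace H]

/-- The usual trace `Tr A ∈ [0, ∞]` of a positive bounded operator `A` on a complex Hilbert space
of arbitrary dimension, computed in some orthonormal basis. The value does not depend on
the basis, see `opTrace_eq_traceAlong`. It is only used for positive operators. -/
noncomputable def opTrace (A : H →L[ℂ] H) : ℝ≥0∞ :=
  traceAlong (exists_hilbertBasis ℂ H).choose_spec.choose A

lemma traceAlong_star_mul_self {ι κ : Type*} (e : HilbertBasis ι ℂ H) (f : HilbertBasis κ ℂ H)
    (B : H →L[ℂ] H) :
    traceAlong e (star B * B) = ∑' j, ENNReal.ofReal (‖(star B) (f j)‖ ^ 2) := by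
  have key : ∀ x : H, RCLike.re ⟪x, (star B * B) x⟫_ℂ = ‖B x‖ ^ 2 := fun x => by
    rw [mul_apply_eq_comp, ContinuousLinearMap.star_eq_adjoint,
      ContinuousLinearMap.adjoint_inner_right, ← norm_sq_eq_re_inner]
  unfold traceAlong
  simp_rw [key, ofReal_norm_sq_eq_tsum f (B _), ofReal_norm_sq_eq_tsum e ((star B) _)]
  rw [ENNReal.tsum_comm]
  refine tsum_congr fun j => tsum_congr fun i => ?_
  rw [ContinuousLinearMap.star_eq_adjoint, ContinuousLinearMap.adjoint_inner_right,
    norm_inner_symm]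

lemma traceAlong_eq {ι κ : Type*} (e : HilbertBasis ι ℂ H) (f : HilbertBasis κ ℂ H)
    {A : H →L[ℂ] H} (hA : 0 ≤ A) : traceAlong e A = traceAlong f A := by
  obtain ⟨B, rfl⟩ := CStarAlgebra.nonneg_iff_eq_star_mul_self.mp hA
  rw [traceAlong_star_mul_self e f, traceAlong_star_mul_self f f]

/-- The trace of a positive operator can be computed in any orthonormal basis. -/
theorem opTrace_eq_traceAlong {ι : Type*} (e : HilbertBasis ι ℂ H)
    {A : H →L[ℂ] H} (hA : 0 ≤ A) : opTrace A = traceAlong e A :=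
  traceAlong_eq _ e hA

/-- `Λ_{α,β,p}(P, X) = Tr |P^{α/p} X P^{β/p}|^p ∈ [0, ∞]`, for a positive invertible `P`; here
`|T| = (T* T)^{1/2}`, and all powers are given by the continuous functional calculus. -/
noncomputable def Lambda (α β p : ℝ) (P X : H →L[ℂ] H) : ℝ≥0∞ :=
  opTrace (CFC.abs (P ^ (α / p) * X * P ^ (β / p)) ^ p)

/-- A completely positive linear map on `B(H)` is *UCPTP* if it is unital and trace preserving.
Every trace class operator is a linear combination of positive ones, so it is enough to ask for
preservation of the trace on positive operators of finite trace. -/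
structure IsUCPTP (φ : (H →L[ℂ] H) →CP (H →L[ℂ] H)) : Prop where
  unital : φ 1 = 1
  trace_preserving : ∀ A : H →L[ℂ] H, 0 ≤ A → opTrace A < ∞ → opTrace (φ A) = opTrace A

/-- A UCPTP map sends positive invertible operators to positive invertible ones, so that
`Lambda α β p (φ P) (φ X)` is meaningful. -/
lemma IsUCPTP.isStrictlyPositive_map {φ : (H →L[ℂ] H) →CP (H →L[ℂ] H)} (hφ : IsUCPTP φ)
    {P : H →L[ℂ] H} (hP : IsStrictlyPositive P) : IsStrictlyPositive (φ P) := by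
  rcases subsingleton_or_nontrivial (H →L[ℂ] H) with hS | hS
  · exact Subsingleton.elim P (φ P) ▸ hP
  obtain ⟨r, hr, h⟩ := (CFC.exists_pos_algebraMap_le_iff hP.isSelfAdjoint).mpr
    (fun x hx => hP.spectrum_pos hx)
  have h1 : φ (algebraMap ℝ (H →L[ℂ] H) r) = algebraMap ℝ (H →L[ℂ] H) r := by
    have : algebraMap ℝ (H →L[ℂ] H) r = (r : ℂ) • (1 : H →L[ℂ] H) := by
      rw [Algebra.algebraMap_eq_smul_one]; rfl
    rw [this, map_smul, hφ.unital]
  have h2 := OrderHomClass.mono φ h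
  rw [h1] at h2
  exact IsStrictlyPositive.of_le (isStrictlyPositive_algebraMap hr) h2

end OperatorTrace

/-!
Write `α = -s`, `β = -(1 - s)` with `s ∈ [0, 1]` and `q = p / 2 ≥ 1`. The inequality is obtained by
complex interpolation from two elementary facts.

* A unital completely positive map is a contraction for the operator norm.
* With all the weight on one side and `p = 2`, the claim is the trace of the Schwarz inequality
  `φ(X)* φ(P)⁻¹ φ(X) ≤ φ(X* P⁻¹ X)` (`CompletelyPositiveMap.schwarz`), which comes from the
  positivity of the `2 × 2` operator matrix `[[P, X], [X*, X* P⁻¹ X]]`.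

The three lines theorem for Hilbert–Schmidt norms (`IsStripBounded.opTrace_le_interp`), applied to
`z ↦ φ(P) ^ (-z/2) φ(P ^ (z/2) Y P ^ ((1-z)/2)) φ(P) ^ (-(1-z)/2)`, interpolates between the weights
on the left and on the right, and gives `p = 2` for all `s` (`IsUCPTP.opTrace_two_le`).

Stein interpolation (`IsStripBounded.opTrace_rpow_le`) then passes from the exponents `∞`
(`re z = 0`) and `2` (`re z = 1`) to `p`, at `z = 2 / p`. For `Y = P ^ (α/p) X P ^ (β/p)` it is applied
to `z ↦ φ(P) ^ (-sz/2) φ(P ^ (sz/2) Y |Y| ^ (pz/2-1) P ^ ((1-s)z/2)) φ(P) ^ (-(1-s)z/2)`. On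
vertical lines the imaginary part of `z` only contributes unitary factors. In place of the powers of
`|Y|` one uses `Y* Y` cut off near `0` (`cutoffPow`), which makes the powers entire in `z` and the
value at `z = 2 / p` Hilbert–Schmidt; neither compactness nor normality of `φ` is needed. The cutoff is removed in
the end by lower semicontinuity of the trace (`opTrace_le_of_tendsto`).
-/

/-! ### The trace and Hilbert–Schmidt norms -/

section Trace

variable {H : Type*} [NormedAddCommGroup H] [InnerProductSpace ℂ H] [CompleteSpace H]

lemma re_inner_star_mul_self_apply (T : H →L[ℂ] H) (x : H) :
    RCLike.re ⟪x, (star T * T) x⟫_ℂ = ‖T x‖ ^ 2 := by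
  rw [mul_apply_eq_comp, ContinuousLinearMap.star_eq_adjoint,
    ContinuousLinearMap.adjoint_inner_right, ← norm_sq_eq_re_inner]

lemma opTrace_star_mul_self {ι : Type*} (e : HilbertBasis ι ℂ H) (T : H →L[ℂ] H) :
    opTrace (star T * T) = ∑' i, ENNReal.ofReal (‖T (e i)‖ ^ 2) := by
  rw [opTrace_eq_traceAlong e (star_mul_self_nonneg T)]
  simp_rw [traceAlong, re_inner_star_mul_self_apply]

lemma opTrace_star_mul_self_comm (T : H →L[ℂ] H) :
    opTrace (star T * T) = opTrace (T * star T) := by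
  obtain ⟨w, e, -⟩ := exists_hilbertBasis ℂ H
  have h := opTrace_star_mul_self e (star T)
  rw [star_star] at h
  rw [h, opTrace_eq_traceAlong e (star_mul_self_nonneg T), traceAlong_star_mul_self e e]

omit [CompleteSpace H] in
lemma re_inner_apply_mono {A B : H →L[ℂ] H} (h : A ≤ B) (x : H) :
    RCLike.re ⟪x, A x⟫_ℂ ≤ RCLike.re ⟪x, B x⟫_ℂ := by
  have := ((ContinuousLinearMap.le_def A B).mp h).re_inner_nonneg_right x
  simpa [inner_sub_right] using this

lemma opTrace_mono {A B : H →L[ℂ] H} (h : A ≤ B) : opTrace A ≤ opTrace B :=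
  ENNReal.tsum_le_tsum fun _ => ENNReal.ofReal_le_ofReal (re_inner_apply_mono h _)

/-- The trace is lower semicontinuous for operator norm limits. -/
lemma opTrace_le_of_tendsto {ι : Type*} {l : Filter ι} [l.NeBot] {A : ι → H →L[ℂ] H}
    {B : H →L[ℂ] H} {c : ℝ≥0∞} (hA : Filter.Tendsto A l (nhds B))
    (h : ∀ᶠ i in l, opTrace (A i) ≤ c) : opTrace B ≤ c := by
  rw [opTrace, traceAlong, ENNReal.tsum_eq_iSup_sum]
  refine iSup_le fun s => ?_
  refine le_of_tendsto (tendsto_finsetSum s fun i _ => ?_)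
    (h.mono fun i hi => (ENNReal.sum_le_tsum s).trans hi)
  refine (ENNReal.continuous_ofReal.tendsto _).comp ?_
  refine ((RCLike.continuous_re.comp ((continuous_const.inner
    (ContinuousLinearMap.apply ℂ H _).continuous))).tendsto B).comp hA

lemma opTrace_mul_left_le (U T : H →L[ℂ] H) :
    opTrace (star (U * T) * (U * T)) ≤ ENNReal.ofReal (‖U‖ ^ 2) * opTrace (star T * T) := by
  obtain ⟨w, e, -⟩ := exists_hilbertBasis ℂ H
  rw [opTrace_star_mul_self e, opTrace_star_mul_self e, ← ENNReal.tsum_mul_left]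
  refine ENNReal.tsum_le_tsum fun i => ?_
  rw [← ENNReal.ofReal_mul (by positivity), ← mul_pow]
  exact ENNReal.ofReal_le_ofReal (by gcongr; exact U.le_opNorm _)

lemma opTrace_mul_right_le (T U : H →L[ℂ] H) :
    opTrace (star (T * U) * (T * U)) ≤ ENNReal.ofReal (‖U‖ ^ 2) * opTrace (star T * T) := by
  have h := opTrace_mul_left_le (star U) (star T)
  rw [← star_mul, norm_star, opTrace_star_mul_self_comm, opTrace_star_mul_self_comm (star T)] at h
  simpa only [star_star] using h

lemma opTrace_mul_left_le_of_norm_le_one {U : H →L[ℂ] H} (hU : ‖U‖ ≤ 1) (T : H →L[ℂ] H) :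
    opTrace (star (U * T) * (U * T)) ≤ opTrace (star T * T) := by
  refine (opTrace_mul_left_le U T).trans ?_
  have : ENNReal.ofReal (‖U‖ ^ 2) ≤ 1 := by
    rw [ENNReal.ofReal_le_one]; exact pow_le_one₀ (norm_nonneg U) hU
  simpa using mul_le_mul_left this (opTrace (star T * T))

lemma opTrace_mul_right_le_of_norm_le_one {U : H →L[ℂ] H} (hU : ‖U‖ ≤ 1) (T : H →L[ℂ] H) :
    opTrace (star (T * U) * (T * U)) ≤ opTrace (star T * T) := by
  refine (opTrace_mul_right_le T U).trans ?_
  have : ENNReal.ofReal (‖U‖ ^ 2) ≤ 1 := by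
    rw [ENNReal.ofReal_le_one]; exact pow_le_one₀ (norm_nonneg U) hU
  simpa using mul_le_mul_left this (opTrace (star T * T))

lemma sum_norm_sq_le {ι : Type*} (e : HilbertBasis ι ℂ H) (T : H →L[ℂ] H) {b : ℝ} (hb : 0 ≤ b)
    (hT : opTrace (star T * T) ≤ ENNReal.ofReal b) (s : Finset ι) :
    ∑ i ∈ s, ‖T (e i)‖ ^ 2 ≤ b := by
  rw [opTrace_star_mul_self e] at hT
  have h := (ENNReal.sum_le_tsum s).trans hT
  rwa [← ENNReal.ofReal_sum_of_nonneg (fun _ _ => by positivity),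
    ENNReal.ofReal_le_ofReal_iff hb] at h

lemma opTrace_le_of_sum_norm_sq_le {ι : Type*} (e : HilbertBasis ι ℂ H) (T : H →L[ℂ] H) {c : ℝ}
    (h : ∀ s : Finset ι, ∑ i ∈ s, ‖T (e i)‖ ^ 2 ≤ c) :
    opTrace (star T * T) ≤ ENNReal.ofReal c := by
  rw [opTrace_star_mul_self e, ENNReal.tsum_eq_iSup_sum]
  refine iSup_le fun s => ?_
  rw [← ENNReal.ofReal_sum_of_nonneg (fun _ _ => by positivity)]
  exact ENNReal.ofReal_le_ofReal (h s)

/-- Cauchy–Schwarz for partial sums of the Hilbert–Schmidt pairing of `R` and `T`. -/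
lemma norm_sum_inner_le {ι : Type*} (e : HilbertBasis ι ℂ H) (R T : H →L[ℂ] H) {b : ℝ}
    (hb : 0 ≤ b) (hT : opTrace (star T * T) ≤ ENNReal.ofReal b) (s : Finset ι) :
    ‖∑ i ∈ s, ⟪R (e i), T (e i)⟫_ℂ‖ ≤ √(∑ i ∈ s, ‖R (e i)‖ ^ 2) * √b :=
  calc _ ≤ ∑ i ∈ s, ‖R (e i)‖ * ‖T (e i)‖ :=
        norm_sum_le_of_le _ fun i _ => norm_inner_le_norm _ _
    _ ≤ √(∑ i ∈ s, ‖R (e i)‖ ^ 2) * √(∑ i ∈ s, ‖T (e i)‖ ^ 2) :=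
        Real.sum_mul_le_sqrt_mul_sqrt _ _ _
    _ ≤ _ := by gcongr; exact sum_norm_sq_le e T hb hT s

end Trace

/-! ### Schwarz inequalities for completely positive maps -/

section CP

variable {A : Type*} [CStarAlgebra A] [PartialOrder A] [StarOrderedRing A]

lemma CStarMatrix.apply_self_nonneg {n : Type*} [Fintype n] {M : CStarMatrix n n A}
    (hM : 0 ≤ M) (i : n) : 0 ≤ M i i := by
  rw [StarOrderedRing.nonneg_iff] at hM
  induction hM using AddSubmonoid.closure_induction with
  | mem M h =>
    obtain ⟨S, rfl⟩ := h
    change 0 ≤ (star S * S) i i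
    rw [CStarMatrix.mul_apply]
    exact Finset.sum_nonneg fun k _ => star_mul_self_nonneg (S k i)
  | zero => exact le_rfl
  | add M N _ _ hM hN => exact add_nonneg hM hN

variable {B : Type*} [CStarAlgebra B] [PartialOrder B] [StarOrderedRing B]

/-- The Schwarz inequality for 2-positive maps: for `p = a* a` and `x = a* b`, where `r` plays the
role of the inverse of `φ p`, this reads `φ(x)* φ(p)⁻¹ φ(x) ≤ φ(x* p⁻¹ x)`. -/
lemma CompletelyPositiveMap.schwarz (φ : A →CP B) (a b : A) {r : B} (hr : IsSelfAdjoint r)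
    (hra : r * φ (star a * a) * r = r) :
    star (φ (star a * b)) * r * φ (star a * b) ≤ φ (star b * b) := by
  -- The image of the positive matrix `[a, b]* [a, b]`, compressed to the vector
  -- `(-r φ(a* b), 1)`, is the difference of the two sides.
  let S : CStarMatrix (Fin 2) (Fin 2) A := CStarMatrix.ofMatrix !![a, b; 0, 0]
  let V : CStarMatrix (Fin 2) (Fin 2) B :=
    CStarMatrix.ofMatrix !![0, -(r * φ (star a * b)); 0, 1]
  have h := CStarMatrix.apply_self_nonneg (star_left_conjugate_nonneg
    (φ.map_cstarMatrix_nonneg _ (star_mul_self_nonneg S)) V) 1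
  have hs : φ (star b * a) = star (φ (star a * b)) := by
    rw [← map_star φ, star_mul, star_star]
  simp only [CStarMatrix.mul_apply, Fin.sum_univ_two, CStarMatrix.star_apply,
    CStarMatrix.map_apply] at h
  simp [S, V, CStarMatrix.ofMatrix_apply, hs, hr.star_eq] at h
  have e : star (φ (star a * b)) * r * φ (star a * a) * (r * φ (star a * b)) =
      star (φ (star a * b)) * r * φ (star a * b) := by
    simp only [← mul_assoc]
    rw [mul_assoc (star _) r, mul_assoc (star _), hra]
  rw [add_mul, neg_mul, e, ← mul_assoc (star _)] at h
  simpa using h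

lemma CompletelyPositiveMap.norm_apply_le (φ : A →CP B) (h1 : φ 1 = 1) (x : A) : ‖φ x‖ ≤ ‖x‖ := by
  have h := φ.schwarz 1 x (r := 1) (.one B) (by simp [h1])
  simp only [star_one, one_mul, mul_one] at h
  have h2 : star x * x ≤ algebraMap ℝ A (‖x‖ ^ 2) := CStarAlgebra.star_mul_le_algebraMap_norm_sq
  have h3 := h.trans (OrderHomClass.mono φ h2)
  have h4 : φ (algebraMap ℝ A (‖x‖ ^ 2)) = algebraMap ℝ B (‖x‖ ^ 2) := by
    rw [Algebra.algebraMap_eq_smul_one, Algebra.algebraMap_eq_smul_one,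
      ← Complex.coe_smul, map_smul, h1, Complex.coe_smul]
  rw [h4] at h3
  have h5 := (CStarAlgebra.norm_le_iff_le_algebraMap _ (by positivity) (star_mul_self_nonneg _)).mpr h3
  rw [CStarRing.norm_star_mul_self, ← sq] at h5
  exact abs_le_of_sq_le_sq' h5 (norm_nonneg _) |>.2

end CP

/-! ### The three lines theorem for Hilbert–Schmidt norms -/

section ThreeLines

/-- An entire function with values in a complex normed space which is bounded on the closed strip
`0 ≤ re z ≤ 1`. -/
structure IsStripBounded {E : Type*} [NormedAddCommGroup E] [NormedSpace ℂ E] (G : ℂ → E) :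
    Prop where
  differentiable : Differentiable ℂ G
  bounded : ∃ C, ∀ z : ℂ, z.re ∈ Set.Icc (0 : ℝ) 1 → ‖G z‖ ≤ C

lemma IsStripBounded.const {E : Type*} [NormedAddCommGroup E] [NormedSpace ℂ E] (x : E) :
    IsStripBounded fun _ => x :=
  ⟨differentiable_const x, ‖x‖, fun _ _ => le_rfl⟩

lemma IsStripBounded.mul {A : Type*} [NormedRing A] [NormedAlgebra ℂ A] {F G : ℂ → A}
    (hF : IsStripBounded F) (hG : IsStripBounded G) : IsStripBounded fun z => F z * G z := by
  obtain ⟨C, hC⟩ := hF.bounded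
  obtain ⟨D, hD⟩ := hG.bounded
  refine ⟨hF.differentiable.mul hG.differentiable, C * D, fun z hz => (norm_mul_le _ _).trans ?_⟩
  have := (norm_nonneg _).trans (hC z hz)
  gcongr
  exacts [hC z hz, hD z hz]

lemma IsStripBounded.clm_comp {E F : Type*} [NormedAddCommGroup E] [NormedSpace ℂ E]
    [NormedAddCommGroup F] [NormedSpace ℂ F] (f : E →L[ℂ] F) {G : ℂ → E} (hG : IsStripBounded G) :
    IsStripBounded fun z => f (G z) := by
  obtain ⟨C, hC⟩ := hG.bounded
  exact ⟨f.differentiable.comp hG.differentiable, ‖f‖ * C, fun z hz =>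
    f.le_opNorm_of_le (hC z hz)⟩

lemma IsStripBounded.norm_le_interp {E : Type*} [NormedAddCommGroup E] [NormedSpace ℂ E]
    {F : ℂ → E} (hF : IsStripBounded F) {a b s : ℝ} (hs : s ∈ Set.Icc (0 : ℝ) 1)
    (ha : ∀ z : ℂ, z.re = 0 → ‖F z‖ ≤ a) (hb : ∀ z : ℂ, z.re = 1 → ‖F z‖ ≤ b) :
    ‖F s‖ ≤ a ^ (1 - s) * b ^ s := by
  have := Complex.HadamardThreeLines.norm_le_interp_of_mem_verticalClosedStrip₀₁' F
    (z := (s : ℂ)) (a := a) (b := b) (by simpa [Complex.HadamardThreeLines.verticalClosedStrip])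
    hF.differentiable.diffContOnCl ?_ ha hb
  · simpa using this
  · obtain ⟨C, hC⟩ := hF.bounded
    exact ⟨C, by rintro _ ⟨z, hz, rfl⟩; exact hC z hz⟩

variable {H : Type*} [NormedAddCommGroup H] [InnerProductSpace ℂ H] [CompleteSpace H]

/-- The three lines theorem for the squared Hilbert–Schmidt norm `Tr G(z)* G(z)`. It is proved by
testing `G z` against `G s` on finite parts of an orthonormal basis, so that `G s` need not be
known to be a Hilbert–Schmidt operator. -/
theorem IsStripBounded.opTrace_le_interp {G : ℂ → H →L[ℂ] H} (hG : IsStripBounded G) {a b s : ℝ}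
    (hs : s ∈ Set.Icc (0 : ℝ) 1) (ha0 : 0 ≤ a) (hb0 : 0 ≤ b)
    (ha : ∀ z : ℂ, z.re = 0 → opTrace (star (G z) * G z) ≤ ENNReal.ofReal a)
    (hb : ∀ z : ℂ, z.re = 1 → opTrace (star (G z) * G z) ≤ ENNReal.ofReal b) :
    opTrace (star (G s) * G s) ≤ ENNReal.ofReal (a ^ (1 - s) * b ^ s) := by
  obtain ⟨w, e, -⟩ := exists_hilbertBasis ℂ H
  refine opTrace_le_of_sum_norm_sq_le e _ fun J => ?_
  set c := ∑ i ∈ J, ‖G s (e i)‖ ^ 2 with hc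
  have hc0 : 0 ≤ c := Finset.sum_nonneg fun _ _ => by positivity
  let f : (H →L[ℂ] H) →L[ℂ] ℂ := ∑ i ∈ J, (innerSL ℂ (G s (e i))).comp
    (ContinuousLinearMap.apply ℂ H (e i))
  have hf : ∀ T, f T = ∑ i ∈ J, ⟪G s (e i), T (e i)⟫_ℂ := fun T => by simp [f]
  have key := (hG.clm_comp f).norm_le_interp hs (a := √c * √a) (b := √c * √b)
    (fun z hz => by rw [hf]; exact norm_sum_inner_le e _ _ ha0 (ha z hz) J)
    (fun z hz => by rw [hf]; exact norm_sum_inner_le e _ _ hb0 (hb z hz) J)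
  have hfs : ‖f (G s)‖ = c := by
    rw [hf]
    simp_rw [inner_self_eq_norm_sq_to_K]
    rw [← abs_of_nonneg hc0, ← Real.norm_eq_abs, ← Complex.norm_real, hc]
    push_cast
    rfl
  rw [hfs] at key
  have hr : (√c * √a) ^ (1 - s) * (√c * √b) ^ s = √c * √(a ^ (1 - s) * b ^ s) := by
    rw [Real.mul_rpow (by positivity) (by positivity), Real.mul_rpow (by positivity) (by positivity),
      Real.sqrt_mul (by positivity), Real.sqrt_eq_rpow a, Real.sqrt_eq_rpow b,
      Real.sqrt_eq_rpow (a ^ _), Real.sqrt_eq_rpow (b ^ _), ← Real.rpow_mul ha0, ← Real.rpow_mul hb0,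
      ← Real.rpow_mul ha0, ← Real.rpow_mul hb0, mul_comm (1 / 2), mul_comm (1 / 2)]
    have : √c ^ (1 - s) * √c ^ s = √c := by
      rw [← Real.rpow_add_of_nonneg (by positivity) (by linarith [hs.2]) hs.1]; simp
    linear_combination (a ^ ((1 - s) * (1 / 2)) * b ^ (s * (1 / 2))) * this
  rw [hr] at key
  by_contra! hlt
  have h1 : √(a ^ (1 - s) * b ^ s) < √c := Real.sqrt_lt_sqrt (by positivity) hlt
  have h2 : √c * √c = c := Real.mul_self_sqrt hc0
  nlinarith [Real.sqrt_nonneg (a ^ (1 - s) * b ^ s)]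

end ThreeLines

/-! ### Complex powers of positive operators -/

section ComplexPowers

open NormedSpace

variable {A : Type*} [CStarAlgebra A]

lemma norm_le_one_of_mem_unitary {u : A} (hu : u ∈ unitary A) : ‖u‖ ≤ 1 := by
  rcases subsingleton_or_nontrivial A with h | h
  · simp [Subsingleton.elim u 0]
  · exact (CStarRing.norm_of_mem_unitary hu).le

lemma exp_add_smul (x : A) (z w : ℂ) : exp ((z + w) • x) = exp (z • x) * exp (w • x) := by
  let +nondep : NormedAlgebra ℚ A := .restrictScalars ℚ ℂ A
  rw [add_smul]
  exact exp_add_of_commute (((Commute.refl x).smul_left z).smul_right w)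

lemma exp_smul_mem_unitary {x : A} (hx : IsSelfAdjoint x) {z : ℂ} (hz : z.re = 0) :
    exp (z • x) ∈ unitary A := by
  have h := (selfAdjoint.expUnitary (z.im • (⟨x, hx⟩ : selfAdjoint A))).2
  rw [selfAdjoint.expUnitary_coe] at h
  convert h using 2
  rw [selfAdjoint.val_smul, ← Complex.coe_smul, smul_smul]
  congr 1
  apply Complex.ext <;> simp [hz]

lemma norm_exp_smul_le {x : A} (hx : IsSelfAdjoint x) (z : ℂ) :
    ‖exp (z • x)‖ ≤ ‖exp ((z.re : ℂ) • x)‖ := by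
  conv_lhs => rw [← Complex.re_add_im z, exp_add_smul]
  exact (norm_mul_le _ _).trans (mul_le_of_le_one_right (norm_nonneg _)
    (norm_le_one_of_mem_unitary (exp_smul_mem_unitary hx (by simp))))

lemma differentiable_exp_smul (x : A) : Differentiable ℂ fun z : ℂ => exp (z • x) :=
  fun z => (hasDerivAt_exp_smul_const x z).differentiableAt

lemma isStripBounded_exp {x : A} (hx : IsSelfAdjoint x) (a b : ℝ) :
    IsStripBounded fun z : ℂ => exp ((a * z + b : ℂ) • x) := by
  refine ⟨(differentiable_exp_smul x).comp (by fun_prop : Differentiable ℂ fun z : ℂ => a * z + b),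
    ?_⟩
  have hc : Continuous fun t : ℝ => ‖exp (((a * t + b : ℝ) : ℂ) • x)‖ :=
    ((differentiable_exp_smul x).continuous.comp
      (by fun_prop : Continuous fun t : ℝ => ((a * t + b : ℝ) : ℂ))).norm
  obtain ⟨C, hC⟩ := (isCompact_Icc (a := (0 : ℝ)) (b := 1)).bddAbove_image hc.continuousOn
  refine ⟨C, fun z hz => (norm_exp_smul_le hx _).trans ?_⟩
  have := hC ⟨z.re, hz, rfl⟩
  simpa using this

lemma exp_smul_cfc {a : A} (ha : IsSelfAdjoint a) {f : ℝ → ℝ} (hf : ContinuousOn f (spectrum ℝ a))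
    (s : ℝ) : exp ((s : ℂ) • cfc f a) = cfc (fun x => Real.exp (s * f x)) a := by
  rw [Complex.coe_smul, ← cfc_const_mul s f a, ← CFC.real_exp_eq_normedSpace_exp,
    ← cfc_comp' Real.exp (fun x => s * f x) a]

/-- The imaginary part of the exponent contributes only a unitary factor, which commutes with the
rest. -/
lemma exp_smul_eq_mul_unitary {x : A} (hx : IsSelfAdjoint x) (z : ℂ) :
    ∃ u ∈ unitary A, exp (z • x) = exp ((z.re : ℂ) • x) * u ∧
      exp (z • x) = u * exp ((z.re : ℂ) • x) := by
  refine ⟨_, exp_smul_mem_unitary hx (z := z.im * Complex.I) (by simp), ?_, ?_⟩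
  · rw [← exp_add_smul, Complex.re_add_im]
  · rw [← exp_add_smul, add_comm, Complex.re_add_im]

variable [PartialOrder A] [StarOrderedRing A]

lemma exp_smul_log {a : A} (ha : IsStrictlyPositive a) (s : ℝ) :
    exp ((s : ℂ) • CFC.log a) = a ^ s := by
  have hpos : ∀ x ∈ spectrum ℝ a, 0 < x := fun x hx => ha.spectrum_pos hx
  rw [CFC.log, exp_smul_cfc ha.isSelfAdjoint
    (Real.continuousOn_log.mono fun x hx => (hpos x hx).ne'), CFC.rpow_eq_cfc_real]
  refine cfc_congr fun x hx => ?_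
  rw [Real.rpow_def_of_pos (hpos x hx), mul_comm]

lemma exp_smul_log_eq_mul_unitary {a : A} (ha : IsStrictlyPositive a) {z : ℂ} {r : ℝ}
    (hr : z.re = r) : ∃ u ∈ unitary A, exp (z • CFC.log a) = a ^ r * u ∧
      exp (z • CFC.log a) = u * a ^ r := by
  obtain ⟨u, hu, h⟩ := exp_smul_eq_mul_unitary (IsSelfAdjoint.log (a := a)) z
  rw [hr, exp_smul_log ha] at h
  exact ⟨u, hu, h⟩

end ComplexPowers

/-! ### The Hilbert–Schmidt case -/

section HilbertSchmidt

open NormedSpace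

variable {H : Type*} [NormedAddCommGroup H] [InnerProductSpace ℂ H] [CompleteSpace H]
  {φ : (H →L[ℂ] H) →CP (H →L[ℂ] H)}

lemma IsUCPTP.exists_clm (hφ : IsUCPTP φ) :
    ∃ f : (H →L[ℂ] H) →L[ℂ] (H →L[ℂ] H), ∀ x, f x = φ x :=
  ⟨(φ : (H →L[ℂ] H) →ₗ[ℂ] (H →L[ℂ] H)).mkContinuous 1 fun x => by
    simpa using φ.norm_apply_le hφ.unital x, fun _ => rfl⟩

lemma IsUCPTP.opTrace_le (hφ : IsUCPTP φ) {A : H →L[ℂ] H} (hA : 0 ≤ A) :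
    opTrace (φ A) ≤ opTrace A := by
  rcases eq_or_ne (opTrace A) ∞ with h | h
  · simp [h]
  · exact (hφ.trace_preserving A hA h.lt_top).le

/-- The monotonicity for `p = 2` with all the weight on the left: this is the trace of
`φ(X)* φ(P)⁻¹ φ(X) ≤ φ(X* P⁻¹ X)`, for `X = P ^ (1 / 2) Y`. -/
lemma IsUCPTP.opTrace_left_le (hφ : IsUCPTP φ) {P : H →L[ℂ] H} (hP : IsStrictlyPositive P)
    (Y : H →L[ℂ] H) :
    opTrace (star (φ P ^ (-(1 / 2) : ℝ) * φ (P ^ (1 / 2 : ℝ) * Y)) *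
      (φ P ^ (-(1 / 2) : ℝ) * φ (P ^ (1 / 2 : ℝ) * Y))) ≤ opTrace (star Y * Y) := by
  have hφP := hφ.isStrictlyPositive_map hP
  have hsa (x : H →L[ℂ] H) (r : ℝ) : star (x ^ r) = x ^ r :=
    (CFC.rpow_nonneg (a := x) (y := r)).isSelfAdjoint.star_eq
  have hP2 : star (P ^ (1 / 2 : ℝ)) * P ^ (1 / 2 : ℝ) = P := by
    rw [hsa, ← CFC.rpow_add hP.isUnit]; norm_num [CFC.rpow_one P hP.nonneg]
  have hr : φ P ^ (-(1 / 2) : ℝ) * φ P ^ (-(1 / 2) : ℝ) = φ P ^ (-1 : ℝ) := by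
    rw [← CFC.rpow_add hφP.isUnit]; norm_num
  have h1 : φ P ^ (-1 : ℝ) * φ P * φ P ^ (-1 : ℝ) = φ P ^ (-1 : ℝ) := by
    nth_rw 2 [← CFC.rpow_one (φ P) hφP.nonneg]
    rw [CFC.rpow_neg_mul_rpow 1 hφP, one_mul]
  have h := φ.schwarz (P ^ (1 / 2 : ℝ)) Y (r := φ P ^ (-1 : ℝ))
    CFC.rpow_nonneg.isSelfAdjoint (by rw [hP2, h1])
  rw [hsa] at h
  refine le_trans (le_of_eq ?_) ((opTrace_mono h).trans (hφ.opTrace_le (star_mul_self_nonneg Y)))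
  rw [star_mul, hsa, ← hr]
  simp only [mul_assoc]

lemma IsUCPTP.opTrace_map_le (hφ : IsUCPTP φ) (Y : H →L[ℂ] H) :
    opTrace (star (φ Y) * φ Y) ≤ opTrace (star Y * Y) := by
  simpa [hφ.unital] using hφ.opTrace_left_le (P := 1) isStrictlyPositive_one Y

/-- The mirror image of `IsUCPTP.opTrace_left_le`. -/
lemma IsUCPTP.opTrace_right_le (hφ : IsUCPTP φ) {P : H →L[ℂ] H} (hP : IsStrictlyPositive P)
    (Y : H →L[ℂ] H) :
    opTrace (star (φ (Y * P ^ (1 / 2 : ℝ)) * φ P ^ (-(1 / 2) : ℝ)) *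
      (φ (Y * P ^ (1 / 2 : ℝ)) * φ P ^ (-(1 / 2) : ℝ))) ≤ opTrace (star Y * Y) := by
  have hsa (x : H →L[ℂ] H) (r : ℝ) : star (x ^ r) = x ^ r :=
    (CFC.rpow_nonneg (a := x) (y := r)).isSelfAdjoint.star_eq
  have h := hφ.opTrace_left_le hP (star Y)
  have e : φ P ^ (-(1 / 2) : ℝ) * φ (P ^ (1 / 2 : ℝ) * star Y) =
      star (φ (Y * P ^ (1 / 2 : ℝ)) * φ P ^ (-(1 / 2) : ℝ)) := by
    rw [star_mul, ← map_star φ, star_mul, hsa, hsa]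
  rw [e, star_star, star_star] at h
  rwa [opTrace_star_mul_self_comm, opTrace_star_mul_self_comm Y]

/-- The monotonicity for `p = 2`. -/
theorem IsUCPTP.opTrace_two_le (hφ : IsUCPTP φ) {P : H →L[ℂ] H} (hP : IsStrictlyPositive P)
    {s : ℝ} (hs : s ∈ Set.Icc (0 : ℝ) 1) (Y : H →L[ℂ] H) :
    let T := φ P ^ (-(s / 2)) * φ (P ^ (s / 2) * Y * P ^ ((1 - s) / 2)) * φ P ^ (-((1 - s) / 2))
    opTrace (star T * T) ≤ opTrace (star Y * Y) := by
  intro T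
  rcases eq_or_ne (opTrace (star Y * Y)) ∞ with hY | hY
  · simp [hY]
  have hφP := hφ.isStrictlyPositive_map hP
  obtain ⟨f, hf⟩ := hφ.exists_clm
  have hL := IsSelfAdjoint.log (a := P)
  have hK := IsSelfAdjoint.log (a := φ P)
  let G : ℂ → H →L[ℂ] H := fun z =>
    exp (((-(1 / 2) : ℝ) * z + (0 : ℝ) : ℂ) • CFC.log (φ P)) *
    f (exp (((1 / 2 : ℝ) * z + (0 : ℝ) : ℂ) • CFC.log P) * Y *
      exp (((-(1 / 2) : ℝ) * z + (1 / 2 : ℝ) : ℂ) • CFC.log P)) *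
    exp (((1 / 2 : ℝ) * z + (-(1 / 2) : ℝ) : ℂ) • CFC.log (φ P))
  have hG : IsStripBounded G :=
    ((isStripBounded_exp hK _ _).mul ((((isStripBounded_exp hL _ _).mul (.const Y)).mul
      (isStripBounded_exp hL _ _)).clm_comp f)).mul (isStripBounded_exp hK _ _)
  have hT : G s = T := by
    have h1 (a b : ℝ) : ((a : ℂ) * (s : ℂ) + (b : ℂ)) = ((a * s + b : ℝ) : ℂ) := by push_cast; rfl
    simp only [G, T, h1, exp_smul_log hP, exp_smul_log hφP, hf]
    ring_nf
  have hle {u : H →L[ℂ] H} (hu : u ∈ unitary (H →L[ℂ] H)) : ‖u‖ ≤ 1 :=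
    norm_le_one_of_mem_unitary hu
  have key := hG.opTrace_le_interp hs (a := (opTrace (star Y * Y)).toReal)
    (b := (opTrace (star Y * Y)).toReal) ENNReal.toReal_nonneg ENNReal.toReal_nonneg ?_ ?_
  · rw [hT, ← Real.rpow_add_of_nonneg ENNReal.toReal_nonneg (by linarith [hs.2]) hs.1] at key
    simpa [ENNReal.ofReal_toReal hY] using key
  · intro z hz
    rw [ENNReal.ofReal_toReal hY]
    obtain ⟨u, hu, -, h1⟩ := exp_smul_log_eq_mul_unitary hφP
      (z := ((-(1 / 2) : ℝ) * z + (0 : ℝ) : ℂ)) (r := 0) (by simp [hz])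
    obtain ⟨v, hv, h2, -⟩ := exp_smul_log_eq_mul_unitary hφP
      (z := ((1 / 2 : ℝ) * z + (-(1 / 2) : ℝ) : ℂ)) (r := -(1 / 2)) (by simp [hz])
    obtain ⟨x, hx, -, h3⟩ := exp_smul_log_eq_mul_unitary hP
      (z := ((1 / 2 : ℝ) * z + (0 : ℝ) : ℂ)) (r := 0) (by simp [hz])
    obtain ⟨y, hy, -, h4⟩ := exp_smul_log_eq_mul_unitary hP
      (z := ((-(1 / 2) : ℝ) * z + (1 / 2 : ℝ) : ℂ)) (r := 1 / 2) (by simp [hz])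
    rw [CFC.rpow_zero _ hφP.nonneg, mul_one] at h1
    rw [CFC.rpow_zero _ hP.nonneg, mul_one] at h3
    have e : G z = u * (φ (x * Y * y * P ^ (1 / 2 : ℝ)) * φ P ^ (-(1 / 2) : ℝ) * v) := by
      simp only [G, h1, h2, h3, h4, hf, mul_assoc]
    rw [e]
    exact (opTrace_mul_left_le_of_norm_le_one (hle hu) _).trans <|
      (opTrace_mul_right_le_of_norm_le_one (hle hv) _).trans <|
      (hφ.opTrace_right_le hP _).trans <| (opTrace_mul_right_le_of_norm_le_one (hle hy) _).trans <|
      opTrace_mul_left_le_of_norm_le_one (hle hx) _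
  · intro z hz
    rw [ENNReal.ofReal_toReal hY]
    obtain ⟨u, hu, -, h1⟩ := exp_smul_log_eq_mul_unitary hφP
      (z := ((-(1 / 2) : ℝ) * z + (0 : ℝ) : ℂ)) (r := -(1 / 2)) (by simp [hz])
    obtain ⟨v, hv, -, h2⟩ := exp_smul_log_eq_mul_unitary hφP
      (z := ((1 / 2 : ℝ) * z + (-(1 / 2) : ℝ) : ℂ)) (r := 0) (by simp [hz])
    obtain ⟨x, hx, h3, -⟩ := exp_smul_log_eq_mul_unitary hP
      (z := ((1 / 2 : ℝ) * z + (0 : ℝ) : ℂ)) (r := 1 / 2) (by simp [hz])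
    obtain ⟨y, hy, -, h4⟩ := exp_smul_log_eq_mul_unitary hP
      (z := ((-(1 / 2) : ℝ) * z + (1 / 2 : ℝ) : ℂ)) (r := 0) (by simp [hz])
    rw [CFC.rpow_zero _ hφP.nonneg, mul_one] at h2
    rw [CFC.rpow_zero _ hP.nonneg, mul_one] at h4
    have e : G z = u * (φ P ^ (-(1 / 2) : ℝ) * φ (P ^ (1 / 2 : ℝ) * (x * Y * y)) * v) := by
      simp only [G, h1, h2, h3, h4, hf, mul_assoc]
    rw [e]
    exact (opTrace_mul_left_le_of_norm_le_one (hle hu) _).trans <|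
      (opTrace_mul_right_le_of_norm_le_one (hle hv) _).trans <|
      (hφ.opTrace_left_le hP _).trans <| (opTrace_mul_right_le_of_norm_le_one (hle hy) _).trans <|
      opTrace_mul_left_le_of_norm_le_one (hle hx) _

end HilbertSchmidt

/-! ### Regularized complex powers of `T* T` -/

section Cutoff

open NormedSpace Filter Topology

/-- The function `1 - ε / max x ε`, which takes values in `[0, 1]`, vanishes for `x ≤ ε` and tends
to `1` for `x > 0` as `ε → 0`. -/
noncomputable def cutoff (ε x : ℝ) : ℝ := 1 - ε / max x ε

variable {ε : ℝ}

lemma continuous_cutoff (hε : 0 < ε) : Continuous (cutoff ε) := by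
  unfold cutoff
  refine continuous_const.sub (continuous_const.div (by fun_prop) fun x => ?_)
  exact (hε.trans_le (le_max_right x ε)).ne'

lemma continuous_max_rpow (hε : 0 < ε) (r : ℝ) : Continuous fun x : ℝ => max x ε ^ r :=
  (by fun_prop : Continuous fun x : ℝ => max x ε).rpow_const fun x =>
    .inl (hε.trans_le (le_max_right x ε)).ne'

lemma cutoff_nonneg (hε : 0 < ε) (x : ℝ) : 0 ≤ cutoff ε x :=
  sub_nonneg.mpr ((div_le_one (hε.trans_le (le_max_right x ε))).mpr (le_max_right x ε))

lemma cutoff_le_one (hε : 0 < ε) (x : ℝ) : cutoff ε x ≤ 1 :=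
  sub_le_self _ (div_nonneg hε.le (hε.le.trans (le_max_right x ε)))

lemma cutoff_eq_zero (hε : 0 < ε) {x : ℝ} (hx : x ≤ ε) : cutoff ε x = 0 := by
  rw [cutoff, max_eq_right hx, div_self hε.ne', sub_self]

lemma cutoff_sq_le_one (hε : 0 < ε) (x : ℝ) : cutoff ε x ^ 2 ≤ 1 :=
  pow_le_one₀ (cutoff_nonneg hε x) (cutoff_le_one hε x)

lemma mul_one_sub_cutoff_le (hε : 0 < ε) {x : ℝ} : x * (1 - cutoff ε x) ≤ ε := by
  have hm := hε.trans_le (le_max_right x ε)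
  rw [cutoff, sub_sub_cancel, ← mul_div_assoc, div_le_iff₀ hm, mul_comm]
  gcongr
  exact le_max_left _ _

lemma cutoff_mul_max_rpow_sq (hε : 0 < ε) (x r : ℝ) :
    (cutoff ε x * max x ε ^ r) ^ 2 = x ^ (2 * r) * cutoff ε x ^ 2 := by
  rcases le_total x ε with h | h
  · simp [cutoff_eq_zero hε h]
  · rw [max_eq_left h, mul_pow, ← Real.rpow_natCast (x ^ r), ← Real.rpow_mul (hε.le.trans h)]
    push_cast
    rw [mul_comm r, mul_comm]

lemma mul_cutoff_mul_max_rpow_sq (hε : 0 < ε) (x r : ℝ) :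
    x * (cutoff ε x * max x ε ^ r) ^ 2 = x ^ (1 + 2 * r) * cutoff ε x ^ 2 := by
  rcases le_total x ε with h | h
  · simp [cutoff_eq_zero hε h]
  · rw [cutoff_mul_max_rpow_sq hε, Real.rpow_add (hε.trans_le h), Real.rpow_one, mul_assoc]

section Algebra

variable {A : Type*} [CStarAlgebra A]

/-- The regularized complex power of a positive element `a`: it is `c_ε(a) a ^ w`, where `c_ε` is
the cutoff function, so that it makes sense, and is entire in `w`, without `a` being invertible. -/
noncomputable def cutoffPow (ε : ℝ) (a : A) (w : ℂ) : A :=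
  cfc (cutoff ε) a * exp (w • cfc (fun x : ℝ => Real.log (max x ε)) a)

lemma isStripBounded_cutoffPow (ε : ℝ) (a : A) (c d : ℝ) :
    IsStripBounded fun z : ℂ => cutoffPow ε a (c * z + d) :=
  (IsStripBounded.const _).mul (isStripBounded_exp (cfc_predicate _ a) c d)

lemma cutoffPow_ofReal (hε : 0 < ε) {a : A} (ha : IsSelfAdjoint a) (r : ℝ) :
    cutoffPow ε a r = cfc (fun x => cutoff ε x * max x ε ^ r) a := by
  have hpos (x : ℝ) : 0 < max x ε := hε.trans_le (le_max_right x ε)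
  have hlog : Continuous fun x : ℝ => Real.log (max x ε) :=
    (by fun_prop : Continuous fun x : ℝ => max x ε).log fun x => (hpos x).ne'
  rw [cutoffPow, exp_smul_cfc ha hlog.continuousOn,
    cfc_mul _ _ a (continuous_cutoff hε).continuousOn (continuous_max_rpow hε r).continuousOn]
  congr 1
  refine cfc_congr fun x _ => ?_
  rw [Real.rpow_def_of_pos (hpos x), mul_comm]

lemma cutoffPow_eq_mul_unitary (hε : 0 < ε) {a : A} (ha : IsSelfAdjoint a) {w : ℂ} {r : ℝ}
    (hr : w.re = r) : ∃ u ∈ unitary A,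
      cutoffPow ε a w = cfc (fun x => cutoff ε x * max x ε ^ r) a * u := by
  obtain ⟨u, hu, h, -⟩ := exp_smul_eq_mul_unitary
    (cfc_predicate (fun x : ℝ => Real.log (max x ε)) a) w
  refine ⟨u, hu, ?_⟩
  rw [← cutoffPow_ofReal hε ha, cutoffPow, cutoffPow, h, hr, mul_assoc]

lemma norm_cutoffPow_le_one (hε : 0 < ε) {a : A} (ha : IsSelfAdjoint a) {w : ℂ} (hw : w.re = 0) :
    ‖cutoffPow ε a w‖ ≤ 1 := by
  obtain ⟨u, hu, h⟩ := cutoffPow_eq_mul_unitary hε ha hw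
  rw [h]
  refine (norm_mul_le _ _).trans (mul_le_one₀ (norm_cfc_le zero_le_one fun x _ => ?_)
    (norm_nonneg _) (norm_le_one_of_mem_unitary hu))
  rw [Real.rpow_zero, mul_one, Real.norm_of_nonneg (cutoff_nonneg hε x)]
  exact cutoff_le_one hε x

lemma star_mul_cfc_self (t : A) {f : ℝ → ℝ} (hf : Continuous f) :
    star (t * cfc f (star t * t)) * (t * cfc f (star t * t)) =
      cfc (fun x => x * f x ^ 2) (star t * t) := by
  have hs : IsSelfAdjoint (star t * t) := .star_mul_self t
  have h : cfc (fun x => f x * x * f x) (star t * t) =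
      cfc f (star t * t) * (star t * t) * cfc f (star t * t) := by
    rw [cfc_mul (fun x => f x * x) f _ (by fun_prop) (by fun_prop), cfc_mul f (fun x => x) _
      (by fun_prop) (by fun_prop), cfc_id' ℝ (star t * t)]
  have h2 : (fun x => x * f x ^ 2) = fun x => f x * x * f x := by ext x; ring
  rw [h2, h, star_mul, (cfc_predicate f (star t * t) : IsSelfAdjoint _).star_eq]
  simp only [mul_assoc]

lemma star_cfc_mul_cfc_self {a : A} {f : ℝ → ℝ} (hf : Continuous f) :
    star (cfc f a) * cfc f a = cfc (fun x => f x ^ 2) a := by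
  rw [(cfc_predicate f a : IsSelfAdjoint _).star_eq, ← cfc_mul f f a]
  simp only [sq]

lemma norm_mul_cutoffPow_le_one (hε : 0 < ε) (t : A) {w : ℂ} (hw : w.re = -(1 / 2)) :
    ‖t * cutoffPow ε (star t * t) w‖ ≤ 1 := by
  obtain ⟨u, hu, h⟩ := cutoffPow_eq_mul_unitary hε (.star_mul_self t) hw
  rw [h, ← mul_assoc]
  refine (norm_mul_le _ _).trans (mul_le_one₀ ?_ (norm_nonneg _) (norm_le_one_of_mem_unitary hu))
  rw [← sq_le_one_iff₀ (norm_nonneg _), sq, ← CStarRing.norm_star_mul_self,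
    star_mul_cfc_self t (f := fun x => cutoff ε x * max x ε ^ (-(1 / 2) : ℝ))
      ((continuous_cutoff hε).mul (continuous_max_rpow hε _))]
  refine norm_cfc_le zero_le_one fun x _ => ?_
  rw [mul_cutoff_mul_max_rpow_sq hε]
  have e : (1 + 2 * -(1 / 2) : ℝ) = 0 := by norm_num
  rw [e, Real.rpow_zero, one_mul, Real.norm_of_nonneg (by positivity)]
  exact cutoff_sq_le_one hε x

variable [PartialOrder A] [StarOrderedRing A]

lemma tendsto_mul_cutoffPow_zero (t : A) :
    Tendsto (fun ε => t * cutoffPow ε (star t * t) 0) (𝓝[>] 0) (𝓝 t) := by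
  rw [tendsto_iff_norm_sub_tendsto_zero]
  have hlim : Tendsto (fun ε : ℝ => √ε) (𝓝[>] 0) (𝓝 0) := by
    simpa using (Real.continuous_sqrt.tendsto 0).mono_left nhdsWithin_le_nhds
  refine tendsto_of_tendsto_of_tendsto_of_le_of_le' tendsto_const_nhds hlim
    (.of_forall fun _ => norm_nonneg _) ?_
  filter_upwards [self_mem_nhdsWithin] with ε hε
  rw [Set.mem_Ioi] at hε
  have hs : IsSelfAdjoint (star t * t) := .star_mul_self t
  have hc := continuous_cutoff hε
  have e : t * cutoffPow ε (star t * t) 0 - t =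
      t * cfc (fun x => cutoff ε x - 1) (star t * t) := by
    rw [cfc_sub _ _ _ (by fun_prop) (by fun_prop), cfc_const_one ℝ (star t * t)]
    simp [cutoffPow, mul_sub]
  rw [e]
  refine Real.le_sqrt_of_sq_le ?_
  rw [sq, ← CStarRing.norm_star_mul_self, star_mul_cfc_self t (by fun_prop)]
  refine norm_cfc_le hε.le fun x hx => ?_
  have hx0 : 0 ≤ x := spectrum_nonneg_of_nonneg (star_mul_self_nonneg t) hx
  rw [Real.norm_of_nonneg (by positivity)]
  have h1 := mul_one_sub_cutoff_le hε (x := x)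
  have h2 := cutoff_nonneg hε x
  have h3 := cutoff_le_one hε x
  nlinarith [mul_nonneg hx0 (sub_nonneg.mpr h3)]

lemma tendsto_cfc_rpow_mul_cutoff {a : A} (ha : 0 ≤ a) {q : ℝ} (hq : 1 ≤ q) :
    Tendsto (fun ε => cfc (fun x => x ^ q * cutoff ε x ^ 2) a) (𝓝[>] 0) (𝓝 (a ^ q)) := by
  rw [CFC.rpow_eq_cfc_real]
  have hrq : Continuous fun x : ℝ => x ^ q := Real.continuous_rpow_const (by linarith)
  refine tendsto_cfc_fun ?_ ?_
  · obtain ⟨C, hC⟩ := (ContinuousFunctionalCalculus.isCompact_spectrum (R := ℝ) a).bddAbove_image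
      (Real.continuous_rpow_const (by linarith : 0 ≤ q - 1)).continuousOn
    rw [Metric.tendstoUniformlyOn_iff]
    intro δ hδ
    have hlim : Tendsto (fun ε : ℝ => C * (2 * ε)) (𝓝[>] 0) (𝓝 0) := by
      have : Continuous fun ε : ℝ => C * (2 * ε) := by fun_prop
      simpa using (this.tendsto 0).mono_left nhdsWithin_le_nhds
    filter_upwards [self_mem_nhdsWithin, hlim.eventually (gt_mem_nhds hδ)] with ε hε hεδ x hx
    rw [Set.mem_Ioi] at hε
    have hx0 : 0 ≤ x := spectrum_nonneg_of_nonneg ha hx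
    refine lt_of_le_of_lt ?_ hεδ
    have h1 := mul_one_sub_cutoff_le hε (x := x)
    have h2 := cutoff_nonneg hε x
    have h3 := cutoff_le_one hε x
    have h4 : x ^ q = x ^ (q - 1) * x := by
      rcases hx0.eq_or_lt with rfl | hx0
      · simp [Real.zero_rpow (by linarith : q ≠ 0)]
      · rw [← Real.rpow_add_one hx0.ne']; simp
    have h5 : x ^ (q - 1) ≤ C := hC ⟨x, hx, rfl⟩
    have h6 : 0 ≤ x ^ (q - 1) := by positivity
    have e : x ^ q - x ^ q * cutoff ε x ^ 2 =
        x ^ (q - 1) * (x * (1 - cutoff ε x) * (1 + cutoff ε x)) := by rw [h4]; ring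
    have h7 : 0 ≤ x * (1 - cutoff ε x) := mul_nonneg hx0 (by linarith)
    rw [Real.dist_eq, e, abs_of_nonneg (by positivity)]
    have : x * (1 - cutoff ε x) * (1 + cutoff ε x) ≤ 2 * ε := by nlinarith
    gcongr
    exact h6.trans h5
  · filter_upwards [self_mem_nhdsWithin] with ε hε
    exact (hrq.mul ((continuous_cutoff hε).pow 2)).continuousOn

lemma continuous_star_mul_self_rpow {q : ℝ} (hq : 0 ≤ q) :
    Continuous fun t : A => (star t * t) ^ q := by
  simp only [CFC.rpow_def]
  refine Continuous.cfc_nnreal (s := fun t => Set.Icc 0 (‖star t * t‖₊ + 1)) _ (by fun_prop)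
    (fun _ => isCompact_Icc) (fun t₀ => ?_) (fun t => ?_) (fun t => star_mul_self_nonneg t)
  · have hc : Continuous fun t : A => ‖star t * t‖₊ := by fun_prop
    filter_upwards [hc.tendsto t₀ |>.eventually (gt_mem_nhds (lt_add_one _))] with t ht x hx
    refine ⟨zero_le, le_trans ?_ ht.le⟩
    have : Nontrivial A := by
      by_contra h
      rw [not_nontrivial_iff_subsingleton] at h
      simp [spectrum.of_subsingleton] at hx
    exact spectrum.le_nnnorm_of_mem hx
  · exact (NNReal.continuous_rpow_const hq).continuousOn

end Algebra

end Cutoff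

/-! ### Interpolation between the operator norm and the Hilbert–Schmidt norm -/

section Interpolation

open Filter Topology

variable {H : Type*} [NormedAddCommGroup H] [InnerProductSpace ℂ H] [CompleteSpace H]

lemma opTrace_mul_cutoffPow_ofReal {ε : ℝ} (hε : 0 < ε) (T : H →L[ℂ] H) (r : ℝ) :
    opTrace (star (T * cutoffPow ε (star T * T) r) * (T * cutoffPow ε (star T * T) r)) =
      opTrace (cfc (fun x => x ^ (1 + 2 * r) * cutoff ε x ^ 2) (star T * T)) := by
  rw [cutoffPow_ofReal hε (.star_mul_self T), star_mul_cfc_self T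
    (f := fun x => cutoff ε x * max x ε ^ r) ((continuous_cutoff hε).mul (continuous_max_rpow hε r))]
  simp_rw [mul_cutoff_mul_max_rpow_sq hε]

lemma opTrace_mul_cutoffPow_le {ε : ℝ} (hε : 0 < ε) (T : H →L[ℂ] H) {w : ℂ} {r : ℝ}
    (hr : w.re = r) :
    opTrace (star (T * cutoffPow ε (star T * T) w) * (T * cutoffPow ε (star T * T) w)) ≤
      opTrace (cfc (fun x => x ^ (1 + 2 * r) * cutoff ε x ^ 2) (star T * T)) := by
  obtain ⟨u, hu, h⟩ := cutoffPow_eq_mul_unitary hε (IsSelfAdjoint.star_mul_self T) hr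
  rw [← cutoffPow_ofReal hε (IsSelfAdjoint.star_mul_self T)] at h
  have h2 := congrArg (T * ·) h
  simp only [← mul_assoc] at h2
  rw [← opTrace_mul_cutoffPow_ofReal hε T r, h2]
  exact opTrace_mul_right_le_of_norm_le_one (norm_le_one_of_mem_unitary hu) _

lemma opTrace_cutoffPow_le {ε : ℝ} (hε : 0 < ε) {Q : H →L[ℂ] H} (hQ : IsSelfAdjoint Q) {w : ℂ}
    {r : ℝ} (hr : w.re = r) :
    opTrace (star (cutoffPow ε Q w) * cutoffPow ε Q w) ≤
      opTrace (cfc (fun x => x ^ (2 * r) * cutoff ε x ^ 2) Q) := by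
  obtain ⟨u, hu, h⟩ := cutoffPow_eq_mul_unitary hε hQ hr
  rw [h]
  refine (opTrace_mul_right_le_of_norm_le_one (norm_le_one_of_mem_unitary hu) _).trans ?_
  rw [star_cfc_mul_cfc_self (f := fun x => cutoff ε x * max x ε ^ r)
    ((continuous_cutoff hε).mul (continuous_max_rpow hε r))]
  simp_rw [cutoff_mul_max_rpow_sq hε]
  exact le_rfl

lemma opTrace_cfc_rpow_mul_cutoff_le {ε : ℝ} (hε : 0 < ε) {Q : H →L[ℂ] H} (hQ : 0 ≤ Q) {q : ℝ}
    (hq : 0 ≤ q) : opTrace (cfc (fun x => x ^ q * cutoff ε x ^ 2) Q) ≤ opTrace (Q ^ q) := by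
  rw [CFC.rpow_eq_cfc_real]
  have hrq : Continuous fun x : ℝ => x ^ q := Real.continuous_rpow_const hq
  refine opTrace_mono (cfc_mono (fun x hx => ?_)
    (hrq.mul ((continuous_cutoff hε).pow 2)).continuousOn hrq.continuousOn)
  have hx0 : 0 ≤ x := spectrum_nonneg_of_nonneg hQ hx
  exact mul_le_of_le_one_right (by positivity) (cutoff_sq_le_one hε x)

/-- Stein interpolation: if `G` is an analytic family of contractions on `re z = 0` and of operators
of squared Hilbert–Schmidt norm at most `a` on `re z = 1`, then `Tr |G(1 / q)| ^ (2 q) ≤ a`. -/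
theorem IsStripBounded.opTrace_rpow_le {G : ℂ → H →L[ℂ] H} (hG : IsStripBounded G) {a q : ℝ}
    (ha : 0 ≤ a) (hq : 1 ≤ q) (h0 : ∀ z : ℂ, z.re = 0 → ‖G z‖ ≤ 1)
    (h1 : ∀ z : ℂ, z.re = 1 → opTrace (star (G z) * G z) ≤ ENNReal.ofReal a)
    {T : H →L[ℂ] H} (hT : G (q⁻¹ : ℝ) = T) (hfin : opTrace (star T * T) < ∞) :
    opTrace ((star T * T) ^ q) ≤ ENNReal.ofReal a := by
  have hq0 : 0 < q := by linarith
  have hQ := star_mul_self_nonneg T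
  refine opTrace_le_of_tendsto (tendsto_cfc_rpow_mul_cutoff hQ hq) ?_
  filter_upwards [self_mem_nhdsWithin] with ε hε
  rw [Set.mem_Ioi] at hε
  -- With `Q = T* T`, the family `G(z) c_ε(Q) Q ^ (q (1 - z) / 2)` has squared Hilbert–Schmidt norm
  -- at most `b = Tr Q ^ q c_ε(Q) ^ 2` on `re z = 0`, at most `a` on `re z = 1`, and exactly `b` at
  -- `z = 1 / q`; the three lines theorem gives `b ≤ b ^ (1 - 1 / q) a ^ (1 / q)`, and `b < ∞`.
  set b := opTrace (cfc (fun x => x ^ q * cutoff ε x ^ 2) (star T * T)) with hb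
  have hTb : opTrace (star (T * cutoffPow ε (star T * T) ((q - 1) / 2 : ℝ)) *
      (T * cutoffPow ε (star T * T) ((q - 1) / 2 : ℝ))) = b := by
    rw [opTrace_mul_cutoffPow_ofReal hε, hb]
    ring_nf
  have hbfin : b ≠ ∞ := by
    rw [← hTb]
    exact ((opTrace_mul_right_le _ _).trans_lt (ENNReal.mul_lt_top ENNReal.ofReal_lt_top hfin)).ne
  have key := (hG.mul (isStripBounded_cutoffPow ε (star T * T) (-(q / 2)) (q / 2))).opTrace_le_interp
    (s := q⁻¹) (a := b.toReal) (b := a) ⟨by positivity, inv_le_one_of_one_le₀ hq⟩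
    ENNReal.toReal_nonneg ha (fun z hz => ?_) (fun z hz => ?_)
  · have e : (((-(q / 2) : ℝ) : ℂ) * ((q⁻¹ : ℝ) : ℂ) + ((q / 2 : ℝ) : ℂ)) =
        (((q - 1) / 2 : ℝ) : ℂ) := by
      rw [← Complex.ofReal_mul, ← Complex.ofReal_add]
      congr 1
      field_simp
      ring
    rw [e, hT, hTb] at key
    set c := b.toReal with hc
    rw [← ENNReal.ofReal_toReal hbfin, ← hc] at key ⊢
    refine ENNReal.ofReal_le_ofReal ?_
    have hc0 : 0 ≤ c := ENNReal.toReal_nonneg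
    rw [ENNReal.ofReal_le_ofReal_iff (by positivity)] at key
    rcases hc0.eq_or_lt with h | hc0
    · rwa [← h]
    rw [Real.rpow_sub hc0, Real.rpow_one, div_mul_eq_mul_div, le_div_iff₀ (by positivity)] at key
    exact (Real.rpow_le_rpow_iff hc0.le ha (by positivity)).mp (le_of_mul_le_mul_left key hc0)
  · rw [ENNReal.ofReal_toReal hbfin]
    refine (opTrace_mul_left_le_of_norm_le_one (h0 z hz) _).trans ?_
    refine (opTrace_cutoffPow_le hε (.star_mul_self T) (r := q / 2) (by simp [hz])).trans_eq ?_
    rw [hb]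
    ring_nf
  · refine (opTrace_mul_right_le_of_norm_le_one ?_ _).trans (h1 z hz)
    exact norm_cutoffPow_le_one hε (.star_mul_self T) (by simp [hz])

end Interpolation

/-! ### Monotonicity of `Λ` -/

section Monotonicity

open Filter Topology NormedSpace

variable {H : Type*} [NormedAddCommGroup H] [InnerProductSpace ℂ H] [CompleteSpace H]
  {φ : (H →L[ℂ] H) →CP (H →L[ℂ] H)}

lemma abs_rpow_eq (T : H →L[ℂ] H) {p : ℝ} (hp : 0 ≤ p) :
    CFC.abs T ^ p = (star T * T) ^ (p / 2) := by
  rw [← CFC.abs_mul_abs, ← sq, ← CFC.rpow_natCast _ 2,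
    CFC.rpow_rpow_of_exponent_nonneg _ _ _ (by positivity) (by positivity)]
  congr 1
  push_cast
  ring

/-- The monotonicity for `X = P ^ (s / (2 q)) Y P ^ ((1 - s) / (2 q))`, where the input `Y` is
regularized by the cutoff function. -/
lemma IsUCPTP.opTrace_cutoff_le (hφ : IsUCPTP φ) {P : H →L[ℂ] H} (hP : IsStrictlyPositive P)
    {s q ε : ℝ} (hs : s ∈ Set.Icc (0 : ℝ) 1) (hq : 1 ≤ q) (hε : 0 < ε) (Y : H →L[ℂ] H)
    (hY : opTrace ((star Y * Y) ^ q) ≠ ∞) :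
    let T := φ P ^ (-(s / (2 * q))) *
      φ (P ^ (s / (2 * q)) * (Y * cutoffPow ε (star Y * Y) 0) * P ^ ((1 - s) / (2 * q))) *
      φ P ^ (-((1 - s) / (2 * q)))
    opTrace ((star T * T) ^ q) ≤ opTrace ((star Y * Y) ^ q) := by
  intro T
  have hφP := hφ.isStrictlyPositive_map hP
  have hq0 : 0 < q := by linarith
  obtain ⟨f, hf⟩ := hφ.exists_clm
  have hL := IsSelfAdjoint.log (a := P)
  have hK := IsSelfAdjoint.log (a := φ P)
  have hQ := star_mul_self_nonneg Y
  have hle {u : H →L[ℂ] H} (hu : u ∈ unitary (H →L[ℂ] H)) : ‖u‖ ≤ 1 :=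
    norm_le_one_of_mem_unitary hu
  let G : ℂ → H →L[ℂ] H := fun z =>
    exp (((-(s / 2) : ℝ) * z + (0 : ℝ) : ℂ) • CFC.log (φ P)) *
    f (exp (((s / 2 : ℝ) * z + (0 : ℝ) : ℂ) • CFC.log P) *
      (Y * cutoffPow ε (star Y * Y) ((q / 2 : ℝ) * z + (-(1 / 2) : ℝ))) *
      exp ((((1 - s) / 2 : ℝ) * z + (0 : ℝ) : ℂ) • CFC.log P)) *
    exp (((-((1 - s) / 2) : ℝ) * z + (0 : ℝ) : ℂ) • CFC.log (φ P))
  have hG : IsStripBounded G :=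
    ((isStripBounded_exp hK _ _).mul ((((isStripBounded_exp hL _ _).mul
      ((IsStripBounded.const Y).mul (isStripBounded_cutoffPow ε (star Y * Y) _ _))).mul
      (isStripBounded_exp hL _ _)).clm_comp f)).mul (isStripBounded_exp hK _ _)
  have hbound {w : ℂ} (hw : w.re = (q - 1) / 2) :
      opTrace (star (Y * cutoffPow ε (star Y * Y) w) * (Y * cutoffPow ε (star Y * Y) w)) ≤
        opTrace ((star Y * Y) ^ q) := by
    refine (opTrace_mul_cutoffPow_le hε Y hw).trans ?_
    rw [show 1 + 2 * ((q - 1) / 2) = q by ring]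
    exact opTrace_cfc_rpow_mul_cutoff_le hε hQ hq0.le
  have hT : G (q⁻¹ : ℝ) = T := by
    have h1 (a b : ℝ) : ((a : ℂ) * ((q⁻¹ : ℝ) : ℂ) + (b : ℂ)) = ((a * q⁻¹ + b : ℝ) : ℂ) := by
      push_cast; rfl
    have h2 : q / 2 * q⁻¹ + -(1 / 2) = 0 := by field_simp; ring
    have h3 (a : ℝ) : a / 2 * q⁻¹ + 0 = a / (2 * q) := by field_simp; ring
    have h4 (a : ℝ) : -(a / 2) * q⁻¹ + 0 = -(a / (2 * q)) := by field_simp; ring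
    simp only [G, T, h1, exp_smul_log hP, exp_smul_log hφP, hf, h2, h3, h4]
    simp only [Complex.ofReal_zero]
  -- The cutoff makes `T` a Hilbert–Schmidt operator.
  have hfin : opTrace (star T * T) < ∞ := by
    have hmul {S U : H →L[ℂ] H} (hS : opTrace (star S * S) < ∞) :
        opTrace (star (S * U) * (S * U)) < ∞ :=
      (opTrace_mul_right_le _ _).trans_lt (ENNReal.mul_lt_top ENNReal.ofReal_lt_top hS)
    have hmul' {S U : H →L[ℂ] H} (hS : opTrace (star S * S) < ∞) :
        opTrace (star (U * S) * (U * S)) < ∞ :=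
      (opTrace_mul_left_le _ _).trans_lt (ENNReal.mul_lt_top ENNReal.ofReal_lt_top hS)
    refine hmul (hmul' ((hφ.opTrace_map_le _).trans_lt (hmul (hmul' ?_))))
    have e : Y * cutoffPow ε (star Y * Y) 0 = Y * cutoffPow ε (star Y * Y) ((q - 1) / 2 : ℝ) *
        exp (((-((q - 1) / 2) : ℝ) : ℂ) • cfc (fun x : ℝ => Real.log (max x ε)) (star Y * Y)) := by
      rw [cutoffPow, cutoffPow, mul_assoc, mul_assoc, ← exp_add_smul, ← Complex.ofReal_add,
        add_neg_cancel, Complex.ofReal_zero]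
    rw [e]
    exact hmul ((hbound (by simp)).trans_lt hY.lt_top)
  have key := hG.opTrace_rpow_le (a := (opTrace ((star Y * Y) ^ q)).toReal)
    ENNReal.toReal_nonneg hq ?_ ?_ hT hfin
  · rwa [ENNReal.ofReal_toReal hY] at key
  · intro z hz
    have h1 {x : H →L[ℂ] H} (hx : IsSelfAdjoint x) (a : ℝ) :
        ‖exp (((a : ℂ) * z + (0 : ℝ) : ℂ) • x)‖ ≤ 1 :=
      hle (exp_smul_mem_unitary hx (by simp [hz]))
    have h2 : ‖Y * cutoffPow ε (star Y * Y) ((q / 2 : ℝ) * z + (-(1 / 2) : ℝ))‖ ≤ 1 :=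
      norm_mul_cutoffPow_le_one hε Y (by simp [hz])
    have hm {x y : H →L[ℂ] H} (hx : ‖x‖ ≤ 1) (hy : ‖y‖ ≤ 1) : ‖x * y‖ ≤ 1 :=
      (norm_mul_le _ _).trans (mul_le_one₀ hx (norm_nonneg _) hy)
    refine hm (hm (h1 hK _) ?_) (h1 hK _)
    rw [hf]
    exact (φ.norm_apply_le hφ.unital _).trans (hm (hm (h1 hL _) h2) (h1 hL _))
  · intro z hz
    rw [ENNReal.ofReal_toReal hY]
    obtain ⟨u, hu, -, h1⟩ := exp_smul_log_eq_mul_unitary hφP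
      (z := ((-(s / 2) : ℝ) * z + (0 : ℝ) : ℂ)) (r := -(s / 2)) (by simp [hz])
    obtain ⟨v, hv, h2, -⟩ := exp_smul_log_eq_mul_unitary hφP
      (z := ((-((1 - s) / 2) : ℝ) * z + (0 : ℝ) : ℂ)) (r := -((1 - s) / 2)) (by simp [hz])
    obtain ⟨x, hx, h3, -⟩ := exp_smul_log_eq_mul_unitary hP
      (z := ((s / 2 : ℝ) * z + (0 : ℝ) : ℂ)) (r := s / 2) (by simp [hz])
    obtain ⟨y, hy, -, h4⟩ := exp_smul_log_eq_mul_unitary hP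
      (z := (((1 - s) / 2 : ℝ) * z + (0 : ℝ) : ℂ)) (r := (1 - s) / 2) (by simp [hz])
    set Z := Y * cutoffPow ε (star Y * Y) ((q / 2 : ℝ) * z + (-(1 / 2) : ℝ)) with hZ
    have e : G z = u * (φ P ^ (-(s / 2)) * φ (P ^ (s / 2) * (x * Z * y) * P ^ ((1 - s) / 2)) *
        φ P ^ (-((1 - s) / 2)) * v) := by
      simp only [G, h1, h2, h3, h4, hf]
      rw [← hZ]
      simp only [mul_assoc]
    rw [e]
    exact (opTrace_mul_left_le_of_norm_le_one (hle hu) _).trans <|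
      (opTrace_mul_right_le_of_norm_le_one (hle hv) _).trans <|
      (hφ.opTrace_two_le hP hs _).trans <| (opTrace_mul_right_le_of_norm_le_one (hle hy) _).trans <|
      (opTrace_mul_left_le_of_norm_le_one (hle hx) _).trans <|
      hbound (by simp [hz]; ring)

end Monotonicity

theorem corollary4p5 {H : Type*} [NormedAddCommGroup H] [InnerProductSpace ℂ H] [CompleteSpace H]
    (α β p : ℝ) (hαβ : α + β = -1) (hα : α ∈ Set.Icc (-1 : ℝ) 0) (hp : 2 ≤ p)
    (P X : H →L[ℂ] H) (hP : IsStrictlyPositive P)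
    (φ : (H →L[ℂ] H) →CP (H →L[ℂ] H)) (hφ : IsUCPTP φ) :
    Lambda α β p (φ P) (φ X) ≤ Lambda α β p P X := by
  obtain ⟨s, rfl⟩ : ∃ s, α = -s := ⟨-α, by simp⟩
  obtain rfl : β = -(1 - s) := by linarith
  have hs : s ∈ Set.Icc (0 : ℝ) 1 := ⟨by linarith [hα.2], by linarith [hα.1]⟩
  obtain ⟨q, rfl⟩ : ∃ q, p = 2 * q := ⟨p / 2, by ring⟩
  have hq : 1 ≤ q := by linarith
  have hq0 : 0 ≤ q := by linarith
  rw [Lambda, Lambda, abs_rpow_eq _ (by positivity), abs_rpow_eq _ (by positivity),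
    mul_div_cancel_left₀ q two_ne_zero, neg_div, neg_div]
  set Y := P ^ (-(s / (2 * q))) * X * P ^ (-((1 - s) / (2 * q))) with hYdef
  rcases eq_or_ne (opTrace ((star Y * Y) ^ q)) ∞ with hY | hY
  · simp [hY]
  obtain ⟨f, hf⟩ := hφ.exists_clm
  have hX : X = P ^ (s / (2 * q)) * Y * P ^ ((1 - s) / (2 * q)) := by
    rw [hYdef]
    simp only [mul_assoc]
    rw [CFC.rpow_neg_mul_rpow _ hP, mul_one, ← mul_assoc, CFC.rpow_mul_rpow_neg _ hP, one_mul]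
  -- Remove the cutoff, by continuity of `|T| ^ p` in `T` and lower semicontinuity of the trace.
  let F : (H →L[ℂ] H) → (H →L[ℂ] H) := fun W => φ P ^ (-(s / (2 * q))) *
    f (P ^ (s / (2 * q)) * W * P ^ ((1 - s) / (2 * q))) * φ P ^ (-((1 - s) / (2 * q)))
  have hF : Continuous F := by fun_prop
  have hFY : φ P ^ (-(s / (2 * q))) * φ X * φ P ^ (-((1 - s) / (2 * q))) = F Y := by
    simp only [F]
    rw [← hX, hf]
  rw [hFY]
  refine opTrace_le_of_tendsto ((((continuous_star_mul_self_rpow hq0).comp hF).tendsto Y).comp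
    (tendsto_mul_cutoffPow_zero Y)) ?_
  filter_upwards [self_mem_nhdsWithin] with ε hε
  rw [Set.mem_Ioi] at hε
  have h := hφ.opTrace_cutoff_le hP hs hq hε Y hY
  dsimp only at h
  have e : F (Y * cutoffPow ε (star Y * Y) 0) = φ P ^ (-(s / (2 * q))) *
      φ (P ^ (s / (2 * q)) * (Y * cutoffPow ε (star Y * Y) 0) * P ^ ((1 - s) / (2 * q))) *
      φ P ^ (-((1 - s) / (2 * q))) := by simp only [F, hf]
  rw [← e] at h
  exact h
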